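/- Let $C=[x_0,x_1]\times[y_0,y_1]\subset\mathbb{R}^2$ with $x_0<x_1$ and $y_0<y_1$ be a rectangular cake, to be divided among $n\ge 1$ agents. Agent $i$ has a value-density $v_i$ that is integrable, non-negative and bounded on $C$; the value of a piece $P\subseteq C$ to agent $i$ is $V_i(P)=\int_P v_i(x)\,dx$, and $V_i(C)>0$. A rectangular allocation is a tuple $X=(X_1,\dots,X_n)$ of pairwise disjoint, possibly empty or degenerate rectangles contained in $C$ with sides parallel to those of $C$ (each rectangle may contain any of its sides or none; the $X_i$ need not cover $C$). For $B>0$, the allocation is $(1/B)$-proportional if $V_i(X_i)\ge \frac{1}{Bn}V_i(C)$ for every $i$. Its utilitarian welfare is $W_{\mathrm{util}}(X)=\frac1n\sum_{i=1}^n V_i(X_i)/V_i(C)$ and its Nash welfare is $W_{\mathrm{Nash}}(X)=\bigl(\prod_{i=1}^n V_i(X_i)/V_i(C)\bigr)^{1/n}$. For a welfare function $W$, the $W$-price of $(1/B)$-proportionality is $$\frac{\max_X W(X)}{\max_Y W(Y)},$$ where $X$ ranges over all rectangular allocations and $Y$ over all $(1/B)$-proportional rectangular allocations. Theorem. For all $B\ge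 4$, all $n\geq 1$ and all $C$ and $v_1,\dots,v_n$ as above, both maxima in this ratio exist and the second one is positive, for $W=W_{\mathrm{util}}$ and for $W=W_{\mathrm{Nash}}$, and: 1. the utilitarian price of $(1/B)$-proportionality is $O(\sqrt n)$: it is at most $K\sqrt n$, where $K$ is an absolute constant (independent of $B$, $n$, $C$ and $v_1,\dots,v_n$); 2. the Nash price of $(1/B)$-proportionality is at most $11.2$. -/

import Mathlib

open MeasureTheory

namespace CakeCutting

/-- `v` is a value-density function on the cake `C`: integrable, non-negative and bounded on `C`. -/
structure IsValueDensity (C : Set (ℝ × ℝ)) (v : ℝ × ℝ → ℝ) : Prop where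
  integrableOn : IntegrableOn v C volume
  nonneg : ∀ x ∈ C, 0 ≤ v x
  bounded : ∃ K : ℝ, ∀ x ∈ C, v x ≤ K

/-- The value of a piece `P` to an agent whose value-density is `v`. -/
noncomputable def value (v : ℝ × ℝ → ℝ) (P : Set (ℝ × ℝ)) : ℝ :=
  ∫ x in P, v x

/-- The family of axes-parallel rectangles: products of two intervals. The intervals may be open,
closed, half-open or empty, so that pieces can be disjoint in the literal sense; the boundary of a
rectangle has area zero and hence value zero. -/
def parallelRectangles : Set (Set (ℝ × ℝ)) :=
  {P | ∃ I J : Set ℝ, I.OrdConnected ∧ J.OrdConnected ∧ P = I ×ˢ J}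

/-- An allocation of the cake `C` to `n` agents: pairwise-disjoint Borel subsets of `C`, one for
each agent. Part of the cake may stay unallocated. -/
def IsAllocation {n : ℕ} (C : Set (ℝ × ℝ)) (X : Fin n → Set (ℝ × ℝ)) : Prop :=
  (∀ i, MeasurableSet (X i)) ∧ (∀ i, X i ⊆ C) ∧ ∀ i j, i ≠ j → Disjoint (X i) (X j)

/-- An allocation in which every piece belongs to the family `S` of usable pieces. -/
def IsUsableAllocation {n : ℕ} (C : Set (ℝ × ℝ)) (S : Set (Set (ℝ × ℝ)))
    (X : Fin n → Set (ℝ × ℝ)) : Prop :=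
  IsAllocation C X ∧ ∀ i, X i ∈ S

/-- `r`-proportionality: every agent gets at least `r / n` of the total cake value. -/
def IsProportional {n : ℕ} (r : ℝ) (C : Set (ℝ × ℝ)) (v : Fin n → ℝ × ℝ → ℝ)
    (X : Fin n → Set (ℝ × ℝ)) : Prop :=
  ∀ i, r / n * value (v i) C ≤ value (v i) (X i)

/-- Utilitarian welfare: the arithmetic mean of the agents' normalized values. -/
noncomputable def utilitarianWelfare {n : ℕ} (C : Set (ℝ × ℝ)) (v : Fin n → ℝ × ℝ → ℝ)
    (X : Fin n → Set (ℝ × ℝ)) : ℝ :=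
  1 / n * ∑ i, value (v i) (X i) / value (v i) C

/-- Nash welfare: the geometric mean of the agents' normalized values. -/
noncomputable def nashWelfare {n : ℕ} (C : Set (ℝ × ℝ)) (v : Fin n → ℝ × ℝ → ℝ)
    (X : Fin n → Set (ℝ × ℝ)) : ℝ :=
  (∏ i, value (v i) (X i) / value (v i) C) ^ (1 / n : ℝ)

/-- `p` is the price of the fairness criterion `F` with respect to the welfare function `W`, for
the cake `C` and the family `S` of usable pieces: the ratio of the maximum of `W` over all usable
allocations to the maximum of `W` over the usable allocations that satisfy `F`. Both maxima have
to be attained (so fair allocations have to exist), and the second one has to be positive. -/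
def IsPriceOfFairness {n : ℕ} (C : Set (ℝ × ℝ)) (S : Set (Set (ℝ × ℝ)))
    (W : (Fin n → Set (ℝ × ℝ)) → ℝ) (F : (Fin n → Set (ℝ × ℝ)) → Prop) (p : ℝ) : Prop :=
  ∃ M D : ℝ,
    IsGreatest {w | ∃ X, IsUsableAllocation C S X ∧ w = W X} M ∧
    IsGreatest {w | ∃ Y, IsUsableAllocation C S Y ∧ F Y ∧ w = W Y} D ∧
    0 < D ∧ p = M / D

end CakeCutting

namespace CakeCutting

/-! Both bounds come from one construction, `exists_redivision`, which turns any allocation `X` into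
a `1/4`-proportional allocation `Y` (hence a `1/B`-proportional one for `B ≥ 4`) while controlling
each agent's loss by a factor `k i + 1` with `∑ k i ≤ n`.

Extend the pieces of `X` to a partition of `C` into `3n + 1` rectangles
(`exists_rectangle_partition`). Each agent demands in every cell the integer part of its value
measured in units of `V_i(C) / (4n)`; rounding costs less than `3n + 1` in total, so at least `n`
units remain. By `exists_assignment` the agents can be distributed over the cells so that a cell
never holds more agents than any of its occupants demands, and an agent sent away from its own cell
has at least as many agents there as it demands. Vertical cuts then divide each cell proportionally
among its occupants (`exists_proportional_division`). With `k i` the number of agents in the cell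
containing `X i`, an agent in its own cell keeps a `1 / k i` share, and an agent elsewhere had a
cell worth less than `k i + 1` units and receives at least one unit.

Cauchy–Schwarz converts the loss factors into `3√n` for utilitarian welfare, and the AM–GM
inequality converts them into `2` for Nash welfare. The maxima exist because the attainable value
vectors form a compact set (`isCompact_values`). -/

/-! ### Completing disjoint rectangles to a partition. -/

theorem exists_update_block {ι β : Type*} (a : ι) (R : Fin 3 → β)
    (S : Option (ι × Fin 3) → β) :
    ∃ F : Option (ι × Fin 3) → β, (∀ j, F (some (a, j)) = R j) ∧
      ∀ k, (∀ j, k ≠ some (a, j)) → F k = S k := by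
  classical
  refine ⟨fun k => if h : ∃ j, k = some (a, j) then R h.choose else S k, fun j => ?_, ?_⟩
  · have h : ∃ j', (some (a, j) : Option (ι × Fin 3)) = some (a, j') := ⟨j, rfl⟩
    have h2 : j = h.choose := by
      have h2 := h.choose_spec
      simpa only [Option.some.injEq, Prod.mk.injEq, true_and] using h2
    exact (dif_pos h).trans (congrArg R h2.symm)
  · intro k hk
    have : ¬ ∃ j, k = some (a, j) := by push Not; exact hk
    simp only [dif_neg this]

/-- Pairwise disjoint rectangles inside a rectangle extend to a partition of the big rectangle
into rectangles, with at most two blanks per given rectangle and one more. -/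
theorem exists_rectangle_partition {A B : Set ℝ} (hA : A.OrdConnected) (hB : B.OrdConnected)
    {ι : Type*} [DecidableEq ι] (I J : ι → Set ℝ) (hI : ∀ i, (I i).OrdConnected)
    (hJ : ∀ i, (J i).OrdConnected) (hsub : ∀ i, I i ×ˢ J i ⊆ A ×ˢ B)
    (hdisj : ∀ i j, i ≠ j → Disjoint (I i ×ˢ J i) (I j ×ˢ J j)) (s : Finset ι) :
    ∃ P Q : Option (ι × Fin 3) → Set ℝ,
      (∀ k, (P k).OrdConnected) ∧ (∀ k, (Q k).OrdConnected) ∧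
      (∀ k, P k ⊆ A) ∧ (∀ k, Q k ⊆ B) ∧
      (∀ k l x y, x ∈ P k → y ∈ Q k → x ∈ P l → y ∈ Q l → k = l) ∧
      (∀ x ∈ A, ∀ y ∈ B, ∃ k, x ∈ P k ∧ y ∈ Q k) ∧
      (∀ i ∈ s, (I i ×ˢ J i).Nonempty → I i ⊆ P (some (i, 0)) ∧ Q (some (i, 0)) = J i) ∧
      (∀ i ∉ s, ∀ j, P (some (i, j)) = ∅) ∧
      (∀ k, ∀ x ∈ A, ∀ x' ∈ A, x ≤ x' →
        (∀ i ∈ s, (I i ×ˢ J i).Nonempty → ∃ w ∈ I i, w ≤ x) → x ∈ P k → x' ∈ P k) := by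
  classical
  -- Upper sets are ordered by reverse inclusion, so rectangles enter from left to right by their
  -- left ends. The last clause of the statement is the sweep invariant: beyond all left ends met so
  -- far, every cell runs on to the right end of `A`.
  induction s using Finset.induction_on_max_value (fun i => upperClosure (I i)) with
  | empty =>
    refine ⟨fun k => if k = none then A else ∅, fun k => if k = none then B else ∅,
      fun k => ?_, fun k => ?_, fun k => ?_, fun k => ?_, ?_, ?_, ?_, ?_, ?_⟩
    · dsimp only; split_ifs
      exacts [hA, Set.ordConnected_empty]
    · dsimp only; split_ifs
      exacts [hB, Set.ordConnected_empty]
    · dsimp only; split_ifs <;> simp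
    · dsimp only; split_ifs <;> simp
    · intro k l x y hx _ hx' _
      by_cases hk : k = none <;> by_cases hl : l = none <;> simp_all
    · intro x hx y hy
      exact ⟨none, by simpa using hx, by simpa using hy⟩
    · simp
    · simp
    · intro k x hx x' hx' _ _ hk
      by_cases h : k = none <;> simp_all
  | insert a s ha hmax ih =>
    obtain ⟨P, Q, hP, hQ, hPA, hQB, hd, hc, hX, he, hs⟩ := ih
    by_cases hne : (I a ×ˢ J a).Nonempty
    swap
    · refine ⟨P, Q, hP, hQ, hPA, hQB, hd, hc, ?_, ?_, ?_⟩
      · intro i hi hn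
        rcases Finset.mem_insert.1 hi with rfl | hi
        · exact absurd hn hne
        · exact hX i hi hn
      · intro i hi
        exact he i fun h => hi (Finset.mem_insert_of_mem h)
      · intro k x hx x' hx' hxx hi
        exact hs k x hx x' hx' hxx fun i h => hi i (Finset.mem_insert_of_mem h)
    obtain ⟨⟨u₀, z₀⟩, hu₀, hz₀⟩ := hne
    simp only at hu₀ hz₀
    have hIA : I a ⊆ A := fun u hu => (hsub a (Set.mk_mem_prod hu hz₀)).1
    have hJB : J a ⊆ B := fun z hz => (hsub a (Set.mk_mem_prod hu₀ hz)).2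
    set U : Set ℝ := {x | x ∈ A ∧ ∃ u ∈ I a, u ≤ x} with hU
    have hUup : ∀ x ∈ U, ∀ x' ∈ A, x ≤ x' → x' ∈ U := fun x hx x' hx' h =>
      ⟨hx', hx.2.imp fun u hu => ⟨hu.1, hu.2.trans h⟩⟩
    have hUord : U.OrdConnected := ⟨fun x hx z hz y hy =>
      hUup x hx y (hA.out hx.1 hz.1 hy) hy.1⟩
    have hmax' : ∀ i ∈ s, ∀ x ∈ U, ∃ w ∈ I i, w ≤ x := by
      rintro i hi x ⟨_, u, hu, hux⟩
      have : u ∈ upperClosure (I i) := hmax i hi (subset_upperClosure hu)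
      obtain ⟨w, hw, hwu⟩ := mem_upperClosure.1 this
      exact ⟨w, hw, hwu.trans hux⟩
    -- Rightwards this is the invariant. Leftwards, the cell covering the point further left extends
    -- to `x` by the invariant, so it is the same cell.
    have hstrip : ∀ k, (P k ∩ U).Nonempty → (Q k).Nonempty → U ⊆ P k := by
      rintro k ⟨x, hxP, hxU⟩ ⟨y, hy⟩ x' hx'
      rcases le_total x x' with h | h
      · exact hs k x hxU.1 x' hx'.1 h (fun i hi _ => hmax' i hi x hxU) hxP
      · obtain ⟨l, hl, hly⟩ := hc x' hx'.1 y (hQB k hy)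
        have := hs l x' hx'.1 x hxU.1 h (fun i hi _ => hmax' i hi x' hx') hl
        rwa [hd k l x y hxP hy this hly]
    -- The cells hit by `U ×ˢ J a`. They lose `U`, and the freed strip `U ×ˢ H` is recut into three
    -- rows: `J a`, the part above it and the part below it.
    set O : Option (ι × Fin 3) → Prop := fun k => (Q k ∩ J a).Nonempty ∧ (P k ∩ U).Nonempty
      with hO
    have hOU : ∀ k, O k → U ⊆ P k := fun k hk =>
      hstrip k hk.2 (hk.1.mono Set.inter_subset_left)
    set H : Set ℝ := J a ∪ ⋃ k ∈ {k | O k}, Q k with hH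
    have hHB : H ⊆ B := Set.union_subset hJB (Set.iUnion₂_subset fun k _ => hQB k)
    have hHmem : ∀ y, y ∈ H ↔ y ∈ J a ∨ ∃ k, O k ∧ y ∈ Q k := by
      intro y; simp [hH]
    have hHord : H.OrdConnected := by
      rw [← isPreconnected_iff_ordConnected]
      refine isPreconnected_of_forall z₀ fun y hy => ?_
      rcases (hHmem y).1 hy with h | ⟨k, hk, h⟩
      · exact ⟨J a, Set.subset_union_left, hz₀, h, isPreconnected_iff_ordConnected.2 (hJ a)⟩
      · obtain ⟨w, hw, hw'⟩ := hk.1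
        exact ⟨J a ∪ Q k, fun z hz => (hHmem z).2 (hz.imp id fun hz => ⟨k, hk, hz⟩),
          Or.inl hz₀, Or.inr h, IsPreconnected.union w hw' hw
            (isPreconnected_iff_ordConnected.2 (hJ a))
            (isPreconnected_iff_ordConnected.2 (hQ k))⟩
    obtain ⟨P', hPn, hPo⟩ := exists_update_block a (fun _ => U)
      (fun k => if O k then P k \ U else P k)
    obtain ⟨Q', hQn, hQo⟩ := exists_update_block a
      ![J a, {y | y ∈ H ∧ ∀ z ∈ J a, z < y}, {y | y ∈ H ∧ ∀ z ∈ J a, y < z}] Q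
    have hQn0 : Q' (some (a, 0)) = J a := hQn 0
    have hQn1 : Q' (some (a, 1)) = {y | y ∈ H ∧ ∀ z ∈ J a, z < y} := hQn 1
    have hQn2 : Q' (some (a, 2)) = {y | y ∈ H ∧ ∀ z ∈ J a, y < z} := hQn 2
    have hQH : ∀ j, Q' (some (a, j)) ⊆ H := by
      intro j
      fin_cases j
      · change Q' (some (a, 0)) ⊆ H
        rw [hQn0]; exact Set.subset_union_left
      · change Q' (some (a, 1)) ⊆ H
        rw [hQn1]; exact fun y hy => hy.1
      · change Q' (some (a, 2)) ⊆ H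
        rw [hQn2]; exact fun y hy => hy.1
    have hcase : ∀ k : Option (ι × Fin 3), (∃ j, k = some (a, j)) ∨ ∀ j, k ≠ some (a, j) := by
      intro k
      by_cases h : ∃ j, k = some (a, j)
      · exact Or.inl h
      · push Not at h; exact Or.inr h
    have hPP : ∀ k, (∀ j, k ≠ some (a, j)) → P' k ⊆ P k := by
      intro k hk
      rw [hPo k hk]; split_ifs
      exacts [Set.sdiff_subset, subset_rfl]
    have hon : ∀ k, (∀ j, k ≠ some (a, j)) → ∀ x y, x ∈ P' k → y ∈ Q k → x ∈ U → y ∈ H →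
        False := by
      intro k hk x y hx hy hxU hyH
      rw [hPo k hk] at hx
      split_ifs at hx with hOk
      · exact hx.2 hxU
      · rcases (hHmem y).1 hyH with h | ⟨l, hl, hly⟩
        · exact hOk ⟨⟨y, hy, h⟩, ⟨x, hx, hxU⟩⟩
        · have := hd k l x y hx hy (hOU l hl hxU) hly
          exact hOk (this ▸ hl)
    refine ⟨P', Q', fun k => ?_, fun k => ?_, fun k => ?_, fun k => ?_, ?_, ?_, ?_, ?_, ?_⟩
    · rcases hcase k with ⟨j, rfl⟩ | hk
      · rw [hPn]; exact hUord
      · rw [hPo k hk]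
        split_ifs
        · exact ⟨fun x hx z hz y hy => ⟨(hP k).out hx.1 hz.1 hy, fun hyU =>
            hz.2 (hUup y hyU z (hPA k hz.1) hy.2)⟩⟩
        · exact hP k
    · rcases hcase k with ⟨j, rfl⟩ | hk
      · fin_cases j
        · change (Q' (some (a, 0))).OrdConnected
          rw [hQn0]; exact hJ a
        · change (Q' (some (a, 1))).OrdConnected
          rw [hQn1]
          exact ⟨fun x hx z hz y hy => ⟨hHord.out hx.1 hz.1 hy, fun w hw =>
            (hx.2 w hw).trans_le hy.1⟩⟩
        · change (Q' (some (a, 2))).OrdConnected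
          rw [hQn2]
          exact ⟨fun x hx z hz y hy => ⟨hHord.out hx.1 hz.1 hy, fun w hw =>
            hy.2.trans_lt (hz.2 w hw)⟩⟩
      · rw [hQo k hk]; exact hQ k
    · rcases hcase k with ⟨j, rfl⟩ | hk
      · rw [hPn]; exact fun x hx => hx.1
      · exact (hPP k hk).trans (hPA k)
    · rcases hcase k with ⟨j, rfl⟩ | hk
      · exact (hQH j).trans hHB
      · rw [hQo k hk]; exact hQB k
    · intro k l x y hxk hyk hxl hyl
      rcases hcase k with ⟨j, rfl⟩ | hk <;> rcases hcase l with ⟨j', rfl⟩ | hl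
      · suffices j = j' by rw [this]
        clear hxk hxl
        fin_cases j <;> fin_cases j' <;>
          simp only [Fin.zero_eta, Fin.mk_one, Fin.reduceFinMk, hQn0, hQn1, hQn2,
            Set.mem_ofPred_eq] at hyk hyl ⊢
        · exact absurd (hyl.2 y hyk) (lt_irrefl y)
        · exact absurd (hyl.2 y hyk) (lt_irrefl y)
        · exact absurd (hyk.2 y hyl) (lt_irrefl y)
        · exact absurd ((hyk.2 z₀ hz₀).trans (hyl.2 z₀ hz₀)) (lt_irrefl z₀)
        · exact absurd (hyk.2 y hyl) (lt_irrefl y)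
        · exact absurd ((hyl.2 z₀ hz₀).trans (hyk.2 z₀ hz₀)) (lt_irrefl z₀)
      · rw [hPn] at hxk
        rw [hQo l hl] at hyl
        exact (hon l hl x y hxl hyl hxk (hQH j hyk)).elim
      · rw [hPn] at hxl
        rw [hQo k hk] at hyk
        exact (hon k hk x y hxk hyk hxl (hQH j' hyl)).elim
      · rw [hQo k hk] at hyk
        rw [hQo l hl] at hyl
        exact hd k l x y (hPP k hk hxk) hyk (hPP l hl hxl) hyl
    · intro x hx y hy
      obtain ⟨k, hkx, hky⟩ := hc x hx y hy
      have hk : ∀ j, k ≠ some (a, j) := by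
        rintro j rfl
        rw [he a ha j] at hkx
        exact hkx
      by_cases hOk : O k
      · by_cases hxU : x ∈ U
        · have hyH : y ∈ H := (hHmem y).2 (Or.inr ⟨k, hOk, hky⟩)
          by_cases hyJ : y ∈ J a
          · exact ⟨some (a, 0), by rwa [hPn], by rwa [hQn0]⟩
          rcases lt_or_ge z₀ y with h | h
          · refine ⟨some (a, 1), by rwa [hPn], ?_⟩
            rw [hQn1]
            refine ⟨hyH, fun z hz => ?_⟩
            by_contra! hzy
            exact hyJ ((hJ a).out hz₀ hz ⟨h.le, hzy⟩)
          · refine ⟨some (a, 2), by rwa [hPn], ?_⟩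
            rw [hQn2]
            refine ⟨hyH, fun z hz => ?_⟩
            by_contra! hzy
            exact hyJ ((hJ a).out hz hz₀ ⟨hzy, h⟩)
        · exact ⟨k, by rw [hPo k hk, if_pos hOk]; exact ⟨hkx, hxU⟩, by rwa [hQo k hk]⟩
      · exact ⟨k, by rwa [hPo k hk, if_neg hOk], by rwa [hQo k hk]⟩
    · intro i hi hn
      by_cases hia : i = a
      · subst hia
        refine ⟨?_, hQn0⟩
        rw [hPn]
        exact fun u hu => ⟨hIA hu, u, hu, le_rfl⟩
      · have his : i ∈ s := Finset.mem_of_mem_insert_of_ne hi hia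
        have hk : ∀ j, (some (i, 0) : Option (ι × Fin 3)) ≠ some (a, j) := by
          intro j h
          simp only [Option.some.injEq, Prod.mk.injEq] at h
          exact hia h.1
        obtain ⟨h1, h2⟩ := hX i his hn
        refine ⟨fun x hx => ?_, by rw [hQo _ hk, h2]⟩
        rw [hPo _ hk]
        split_ifs with hOk
        -- Truncation spares earlier rectangles: if `I i` reached into `U` with `J i` meeting `J a`,
        -- the rectangles of `i` and `a` would share a point.
        · refine ⟨h1 hx, fun hxU => ?_⟩
          obtain ⟨y, hy, hy'⟩ := hOk.1
          rw [h2] at hy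
          obtain ⟨hxA, u, hu, hux⟩ := hxU
          obtain ⟨w, hw, hwu⟩ := hmax' i his u ⟨hIA hu, u, hu, le_rfl⟩
          have hui : u ∈ I i := (hI i).out hw hx ⟨hwu, hux⟩
          exact Set.disjoint_left.1 (hdisj i a hia) (Set.mk_mem_prod hui hy)
            (Set.mk_mem_prod hu hy')
        · exact h1 hx
    · intro i hi j
      rw [Finset.mem_insert, not_or] at hi
      have hk : ∀ j', (some (i, j) : Option (ι × Fin 3)) ≠ some (a, j') := by
        intro j' h
        simp only [Option.some.injEq, Prod.mk.injEq] at h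
        exact hi.1 h.1
      exact Set.subset_eq_empty (hPP _ hk) (he i hi.2 j)
    · intro k x hx x' hx' hxx hi hxk
      have hxU : x ∈ U := ⟨hx, hi a (Finset.mem_insert_self a s)
        ⟨(u₀, z₀), Set.mk_mem_prod hu₀ hz₀⟩⟩
      rcases hcase k with ⟨j, rfl⟩ | hk
      · rw [hPn]; exact hUup x hxU x' hx' hxx
      · rw [hPo k hk] at hxk ⊢
        split_ifs at hxk ⊢ with hOk
        · exact absurd hxU hxk.2
        · exact hs k x hx x' hx' hxx
            (fun i h => hi i (Finset.mem_insert_of_mem h)) hxk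

/-! ### Assigning agents to cells. -/

/-- If every agent `a` demands at least as many shares as there are agents, then agents can be
assigned to pieces so that no piece holds more agents than any of them demands there, and an agent
who is not assigned to her own piece is outnumbered there. -/
theorem exists_assignment {N κ : Type*} [Fintype N] [Fintype κ] [DecidableEq N] [DecidableEq κ]
    (q : N → κ → ℕ) (own : N → κ) (hown : Function.Injective own)
    (hq : ∀ a, Fintype.card N ≤ ∑ j, q a j) :
    ∃ f : N → κ, (∀ a, (Finset.univ.filter fun b => f b = f a).card ≤ q a (f a)) ∧
      ∀ a, f a ≠ own a → q a (own a) ≤ (Finset.univ.filter fun b => f b = own a).card := by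
  classical
  let c : (N → Option κ) → κ → ℕ := fun f j => (Finset.univ.filter fun b => f b = some j).card
  let good : (N → Option κ) → Prop := fun f =>
    (∀ a j, f a = some j → c f j ≤ q a j) ∧ ∀ a, f a ≠ some (own a) → q a (own a) ≤ c f (own a)
  -- Among the good partial assignments, one maximising the total demand of agents at their assigned
  -- cells leaves nobody unassigned.
  let Φ : (N → Option κ) → ℕ := fun f => ∑ a, (f a).elim 0 (q a)
  let f₀ : N → Option κ := fun a => if q a (own a) = 0 then none else some (own a)
  have hf₀ : good f₀ := by
    refine ⟨fun a j h => ?_, fun a h => ?_⟩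
    · by_cases h0 : q a (own a) = 0
      · simp [f₀, h0] at h
      · simp only [f₀, h0, if_false, Option.some.injEq] at h
        subst h
        refine le_trans (Finset.card_le_one.2 ?_) (Nat.one_le_iff_ne_zero.2 h0)
        intro b hb b' hb'
        have key : ∀ b, f₀ b = some (own a) → b = a := by
          intro b hb
          simp only [f₀] at hb
          split_ifs at hb
          exact hown (Option.some.inj hb)
        rw [key b (Finset.mem_filter.1 hb).2, key b' (Finset.mem_filter.1 hb').2]
    · by_cases h0 : q a (own a) = 0
      · omega
      · simp [f₀, h0] at h
  obtain ⟨f, hfm, hmax⟩ := Finset.exists_max_image (Finset.univ.filter good) Φ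
    ⟨f₀, by simpa using hf₀⟩
  have hf : good f := (Finset.mem_filter.1 hfm).2
  have hmax : ∀ g, good g → Φ g ≤ Φ f := fun g hg => hmax g (by simpa using hg)
  have hall : ∀ a, f a ≠ none := by
    intro a hfa
    have hlt : ∑ j, c f j < Fintype.card N := by
      have : ∑ j, c f j = (Finset.univ.filter fun b => f b ≠ none).card := by
        rw [Finset.card_eq_sum_card_fiberwise (f := f) (t := Finset.univ.image some)]
        · rw [Finset.sum_image (Option.some_injective κ).injOn]
          refine Finset.sum_congr rfl fun j _ => ?_
          simp only [c]
          congr 1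
          ext b
          simp only [Finset.mem_filter, Finset.mem_univ, true_and]
          constructor
          · intro h; simp [h]
          · exact fun h => h.2
        · intro b hb
          obtain ⟨j, hj⟩ := Option.ne_none_iff_exists'.1 (Finset.mem_filter.1 hb).2
          simp [hj]
      rw [this, ← Finset.card_univ]
      exact Finset.card_lt_card
        ⟨Finset.filter_subset _ _, fun h => by simpa [hfa] using h (Finset.mem_univ a)⟩
    obtain ⟨j, -, hj⟩ := Finset.exists_lt_of_sum_lt (hlt.trans_le (hq a))
    -- Cell `j` has fewer occupants than `a` demands. If some occupant `b` has no slack there, `a`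
    -- replaces `b`: the counts stay the same and `Φ` grows because `q b j ≤ c f j < q a j`.
    -- Otherwise every occupant tolerates one more, and `a` simply joins.
    by_cases hb : ∃ b, f b = some j ∧ q b j ≤ c f j
    · obtain ⟨b, hbj, hbq⟩ := hb
      have hab : a ≠ b := by rintro rfl; simp [hfa] at hbj
      let g : N → Option κ := fun d => if d = a then some j else if d = b then none else f d
      have hga : g a = some j := by simp [g]
      have hgb : g b = none := by simp [g, hab.symm]
      have hgo : ∀ d, d ≠ a → d ≠ b → g d = f d := fun d h h' => by simp [g, h, h']
      have hgsw : ∀ d, g d = f (Equiv.swap a b d) := by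
        intro d
        by_cases h : d = a
        · rw [h, hga, Equiv.swap_apply_left, hbj]
        by_cases h' : d = b
        · rw [h', hgb, Equiv.swap_apply_right, hfa]
        rw [hgo d h h', Equiv.swap_apply_of_ne_of_ne h h']
      have hcg : ∀ l, c g l = c f l := by
        intro l
        simp only [c, hgsw]
        refine Finset.card_bij (fun d _ => Equiv.swap a b d) ?_ ?_ ?_
        · intro d hd; simpa using hd
        · intro d _ d' _ h; exact (Equiv.swap a b).injective h
        · intro d hd
          exact ⟨Equiv.swap a b d, by simpa using hd, by simp⟩
      have hg : good g := by
        refine ⟨fun d l hd => ?_, fun d hd => ?_⟩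
        · rw [hcg]
          by_cases h : d = a
          · subst h
            rw [hga, Option.some.injEq] at hd
            subst hd
            exact hj.le
          by_cases h' : d = b
          · rw [h', hgb] at hd; cases hd
          · rw [hgo d h h'] at hd; exact hf.1 d l hd
        · rw [hcg]
          by_cases h : d = a
          · subst h
            exact hf.2 d (by simp [hfa])
          by_cases h' : d = b
          · subst h'
            by_cases ho : own d = j
            · rw [ho]; exact hbq
            · refine hf.2 d ?_
              rw [hbj]
              simpa using Ne.symm ho
          · rw [hgo d h h'] at hd; exact hf.2 d hd
      have hlt : Φ f < Φ g := by
        have e : ∀ F : N → Option κ, Φ F = (F a).elim 0 (q a) + ((F b).elim 0 (q b) +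
            ∑ d ∈ (Finset.univ.erase a).erase b, (F d).elim 0 (q d)) := by
          intro F
          rw [Finset.add_sum_erase _ (fun d => (F d).elim 0 (q d))
            (Finset.mem_erase.2 ⟨hab.symm, Finset.mem_univ b⟩),
            Finset.add_sum_erase _ (fun d => (F d).elim 0 (q d)) (Finset.mem_univ a)]
        rw [e f, e g, hga, hgb, hfa, hbj]
        have : ∑ d ∈ (Finset.univ.erase a).erase b, (g d).elim 0 (q d) =
            ∑ d ∈ (Finset.univ.erase a).erase b, (f d).elim 0 (q d) := by
          refine Finset.sum_congr rfl fun d hd => ?_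
          simp only [Finset.mem_erase] at hd
          rw [hgo d hd.2.1 hd.1]
        rw [this]
        simp only [Option.elim]
        omega
      exact absurd (hmax g hg) (not_le.2 hlt)
    · push Not at hb
      let g : N → Option κ := fun d => if d = a then some j else f d
      have hga : g a = some j := by simp [g]
      have hgo : ∀ d, d ≠ a → g d = f d := fun d h => by simp [g, h]
      have hcle : ∀ l, c f l ≤ c g l := by
        intro l
        refine Finset.card_le_card fun d hd => ?_
        simp only [Finset.mem_filter, Finset.mem_univ, true_and] at hd ⊢
        rwa [hgo d (by rintro rfl; simp [hfa] at hd)]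
      have hcj : c g j ≤ c f j + 1 := by
        refine (Finset.card_le_card (t := insert a (Finset.univ.filter fun b => f b = some j))
          fun d hd => ?_).trans (Finset.card_insert_le _ _)
        simp only [Finset.mem_filter, Finset.mem_univ, true_and, Finset.mem_insert] at hd ⊢
        by_cases h : d = a
        · exact Or.inl h
        · rw [hgo d h] at hd; exact Or.inr hd
      have hcl : ∀ l, l ≠ j → c g l ≤ c f l := by
        intro l hl
        refine Finset.card_le_card fun d hd => ?_
        simp only [Finset.mem_filter, Finset.mem_univ, true_and] at hd ⊢
        rwa [hgo d (by rintro rfl; rw [hga] at hd; exact hl (Option.some.inj hd).symm)] at hd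
      have hg : good g := by
        refine ⟨fun d l hd => ?_, fun d hd => ?_⟩
        · by_cases h : d = a
          · subst h
            rw [hga, Option.some.injEq] at hd
            subst hd
            omega
          · rw [hgo d h] at hd
            by_cases hl : l = j
            · subst hl
              have := hb d hd
              omega
            · exact (hcl l hl).trans (hf.1 d l hd)
        · refine le_trans ?_ (hcle _)
          by_cases h : d = a
          · subst h
            exact hf.2 d (by simp [hfa])
          · rw [hgo d h] at hd; exact hf.2 d hd
      have hlt : Φ f < Φ g := by
        have e : ∀ F : N → Option κ, Φ F = (F a).elim 0 (q a) +
            ∑ d ∈ Finset.univ.erase a, (F d).elim 0 (q d) := by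
          intro F
          rw [Finset.add_sum_erase _ (fun d => (F d).elim 0 (q d)) (Finset.mem_univ a)]
        rw [e f, e g, hga, hfa]
        have : ∑ d ∈ Finset.univ.erase a, (g d).elim 0 (q d) =
            ∑ d ∈ Finset.univ.erase a, (f d).elim 0 (q d) := by
          refine Finset.sum_congr rfl fun d hd => ?_
          rw [hgo d (Finset.ne_of_mem_erase hd)]
        rw [this]
        simp only [Option.elim]
        omega
      exact absurd (hmax g hg) (not_le.2 hlt)
  choose F hF using fun a => Option.ne_none_iff_exists'.1 (hall a)
  have hcF : ∀ j, (Finset.univ.filter fun b => F b = j).card = c f j := by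
    intro j
    simp only [c, hF, Option.some.injEq]
  refine ⟨F, fun a => ?_, fun a h => ?_⟩
  · rw [hcF]; exact hf.1 a _ (hF a)
  · rw [hcF]; exact hf.2 a (by rw [hF]; simpa using h)

/-! ### Continuity of values under moving sides, and division by vertical cuts. -/

theorem ae_fst_ne {μ : Measure (ℝ × ℝ)} (hμ : μ ≪ volume) (x : ℝ) : ∀ᵐ p ∂μ, p.1 ≠ x := by
  have h : volume ({x} ×ˢ Set.univ : Set (ℝ × ℝ)) = 0 := by
    rw [Measure.volume_eq_prod, Measure.prod_prod]; simp
  refine hμ.ae_le (ae_iff.2 ?_)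
  convert h using 2
  ext p; simp

theorem ae_snd_ne {μ : Measure (ℝ × ℝ)} (hμ : μ ≪ volume) (y : ℝ) : ∀ᵐ p ∂μ, p.2 ≠ y := by
  have h : volume (Set.univ ×ˢ {y} : Set (ℝ × ℝ)) = 0 := by
    rw [Measure.volume_eq_prod, Measure.prod_prod]; simp
  refine hμ.ae_le (ae_iff.2 ?_)
  convert h using 2
  ext p; simp

theorem eventually_lt_iff {α : Type*} [TopologicalSpace α] {f : α → ℝ} {a : α}
    (hf : ContinuousAt f a) {x : ℝ} (hx : x ≠ f a) : ∀ᶠ t in nhds a, (x < f t ↔ x < f a) := by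
  rcases lt_or_gt_of_ne hx with h | h
  · filter_upwards [hf.eventually_const_lt h] with t ht
    exact ⟨fun _ => h, fun _ => ht⟩
  · filter_upwards [hf.eventually_lt_const h] with t ht
    exact ⟨fun h' => absurd h' ht.not_gt, fun h' => absurd h' h.not_gt⟩

theorem eventually_gt_iff {α : Type*} [TopologicalSpace α] {f : α → ℝ} {a : α}
    (hf : ContinuousAt f a) {x : ℝ} (hx : x ≠ f a) : ∀ᶠ t in nhds a, (f t < x ↔ f a < x) := by
  filter_upwards [eventually_lt_iff hf.neg (x := -x) (by simpa using hx)] with t ht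
  simpa using ht

/-- Dominated convergence for indicators. For a rectangle with moving sides, membership of a point
is locally constant unless the point lies on one of the side lines, and these are null. -/
theorem continuous_measureReal {α : Type*} [TopologicalSpace α] [FirstCountableTopology α]
    {μ : Measure (ℝ × ℝ)} [IsFiniteMeasure μ] (S : α → Set (ℝ × ℝ))
    (hS : ∀ a, MeasurableSet (S a))
    (h : ∀ a, ∀ᵐ p ∂μ, ∀ᶠ t in nhds a, (p ∈ S t ↔ p ∈ S a)) :
    Continuous fun a => μ.real (S a) := by
  rw [continuous_iff_continuousAt]
  intro a
  exact (ENNReal.continuousAt_toReal (measure_ne_top μ _)).tendsto.comp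
    (tendsto_measure_of_ae_tendsto_indicator_of_isFiniteMeasure (nhds a) (hS a) hS (h a))

theorem continuous_measureReal_inter_fst_lt {μ : Measure (ℝ × ℝ)} [IsFiniteMeasure μ]
    (hμ : μ ≪ volume) {S : Set (ℝ × ℝ)} (hS : MeasurableSet S) :
    Continuous fun t : ℝ => μ.real (S ∩ {p | p.1 < t}) := by
  refine continuous_measureReal _
    (fun t => hS.inter (measurableSet_lt measurable_fst measurable_const)) fun t => ?_
  filter_upwards [ae_fst_ne hμ t] with p hp
  filter_upwards [eventually_lt_iff continuousAt_id hp] with s hs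
  exact and_congr_right fun _ => hs

/-- Proportional division of a rectangle into rectangles by vertical cuts. -/
theorem exists_proportional_division {N : Type*} [DecidableEq N] (μ : N → Measure (ℝ × ℝ))
    [∀ a, IsFiniteMeasure (μ a)] (hμ : ∀ a, μ a ≪ volume) (c : N → ℝ) (hc : ∀ a, 0 ≤ c a)
    {x₀ x₁ : ℝ} {J : Set ℝ} (hJ : J.OrdConnected) (m : ℕ) :
    ∀ (A : Finset N) (I : Set ℝ), A.card = m → I.OrdConnected → I ⊆ Set.Icc x₀ x₁ →
      (∀ a ∈ A, m * c a ≤ (μ a).real (I ×ˢ J)) →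
      ∃ Y : N → Set (ℝ × ℝ),
        (∀ a ∈ A, Y a ∈ parallelRectangles ∧ Y a ⊆ I ×ˢ J ∧ c a ≤ (μ a).real (Y a)) ∧
        ∀ a ∈ A, ∀ b ∈ A, a ≠ b → Disjoint (Y a) (Y b) := by
  induction m with
  | zero =>
    intro A I hA _ _ _
    rw [Finset.card_eq_zero] at hA
    subst hA
    exact ⟨fun _ => ∅, by simp, by simp⟩
  | succ m ih =>
    intro A I hA hI hIsub hval
    have hS : MeasurableSet (I ×ˢ J) := hI.measurableSet.prod hJ.measurableSet
    have hcut : ∀ a, ∃ t, a ∈ A → (μ a).real ((I ×ˢ J) ∩ {p | p.1 < t}) = c a := by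
      intro a
      by_cases ha : a ∈ A
      swap
      · exact ⟨0, fun h => absurd h ha⟩
      have h0 : (μ a).real ((I ×ˢ J) ∩ {p | p.1 < x₀}) = 0 := by
        have : (I ×ˢ J) ∩ {p | p.1 < x₀} = ∅ := by
          ext p
          simp only [Set.mem_inter_iff, Set.mem_prod, Set.mem_ofPred_eq, Set.mem_empty_iff_false,
            iff_false, not_and, not_lt]
          exact fun h => (hIsub h.1).1
        rw [this, measureReal_empty]
      -- The cut is strict and `I` may contain `x₁`, hence `x₁ + 1`.
      have h1 : (μ a).real ((I ×ˢ J) ∩ {p | p.1 < x₁ + 1}) = (μ a).real (I ×ˢ J) := by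
        congr 1
        rw [Set.inter_eq_left]
        intro p hp
        have := (hIsub hp.1).2
        change p.1 < x₁ + 1
        linarith
      have hle : c a ≤ (μ a).real (I ×ˢ J) := by
        have h := hval a ha
        push_cast at h
        nlinarith [mul_nonneg (Nat.cast_nonneg (α := ℝ) m) (hc a)]
      obtain ⟨t, ht⟩ := mem_range_of_exists_le_of_exists_ge
        (continuous_measureReal_inter_fst_lt (hμ a) hS)
        ⟨x₀, h0.trans_le (hc a)⟩ ⟨x₁ + 1, hle.trans h1.ge⟩
      exact ⟨t, fun _ => ht⟩
    choose t ht using hcut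
    -- The agent with the leftmost mark takes the part to its left. Every other agent values that
    -- part at no more than its own `c b`, so the remainder suffices for the induction.
    obtain ⟨a, haA, hmin⟩ := Finset.exists_min_image A t
      (Finset.card_pos.1 (by omega))
    have hsplit : ∀ s : ℝ, (I ×ˢ J) ∩ {p | p.1 < s} = (I ∩ Set.Iio s) ×ˢ J := by
      intro s; ext p
      simp only [Set.mem_inter_iff, Set.mem_prod, Set.mem_ofPred_eq, Set.mem_Iio]
      tauto
    have hI' : (I ∩ Set.Ici (t a)).OrdConnected := hI.inter Set.ordConnected_Ici
    obtain ⟨Y, hY, hYd⟩ := ih (A.erase a) (I ∩ Set.Ici (t a))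
      (by rw [Finset.card_erase_of_mem haA]; omega) hI'
      (Set.inter_subset_left.trans hIsub) (by
        intro b hb
        have hbA := Finset.mem_of_mem_erase hb
        have h1 : (μ b).real ((I ×ˢ J) ∩ {p | p.1 < t a}) ≤ c b := by
          rw [← ht b hbA]
          refine measureReal_mono ?_
          exact Set.inter_subset_inter_right _ fun p hp => lt_of_lt_of_le hp (hmin b hbA)
        have h2 := measureReal_inter_add_sdiff (μ := μ b) (s := I ×ˢ J)
          (measurableSet_lt measurable_fst measurable_const : MeasurableSet {p : ℝ × ℝ | p.1 < t a})
        have h3 : (I ×ˢ J) \ {p | p.1 < t a} = (I ∩ Set.Ici (t a)) ×ˢ J := by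
          ext p
          simp only [Set.mem_sdiff, Set.mem_prod, Set.mem_ofPred_eq, Set.mem_inter_iff,
            Set.mem_Ici, not_lt]
          tauto
        rw [h3] at h2
        have h4 := hval b hbA
        push_cast at h4
        linarith)
    refine ⟨Function.update Y a ((I ∩ Set.Iio (t a)) ×ˢ J), fun b hb => ?_, ?_⟩
    · by_cases hba : b = a
      · subst hba
        rw [Function.update_self]
        refine ⟨⟨_, _, hI.inter Set.ordConnected_Iio, hJ, rfl⟩,
          Set.prod_mono Set.inter_subset_left subset_rfl, ?_⟩
        rw [← hsplit, ht b hb]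
      · rw [Function.update_of_ne hba]
        obtain ⟨h1, h2, h3⟩ := hY b (Finset.mem_erase.2 ⟨hba, hb⟩)
        exact ⟨h1, h2.trans (Set.prod_mono Set.inter_subset_left subset_rfl), h3⟩
    · have key : ∀ b ∈ A, b ≠ a → Disjoint ((I ∩ Set.Iio (t a)) ×ˢ J) (Y b) := by
        intro b hb hba
        obtain ⟨h1, h2, h3⟩ := hY b (Finset.mem_erase.2 ⟨hba, hb⟩)
        rw [Set.disjoint_left]
        intro p hp hpb
        exact absurd (Set.mem_Ici.1 (h2 hpb).1.2) (not_le.2 hp.1.2)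
      intro b hb d hd hbd
      by_cases hba : b = a
      · subst hba
        rw [Function.update_self, Function.update_of_ne hbd.symm]
        exact key d hd hbd.symm
      · rw [Function.update_of_ne hba]
        by_cases hda : d = a
        · subst hda
          rw [Function.update_self]
          exact (key b hb hba).symm
        · rw [Function.update_of_ne hda]
          exact hYd b (Finset.mem_erase.2 ⟨hba, hb⟩) d (Finset.mem_erase.2 ⟨hda, hd⟩) hbd

/-! ### Redividing an allocation. -/

theorem measurableSet_of_mem_parallelRectangles {P : Set (ℝ × ℝ)}
    (hP : P ∈ parallelRectangles) : MeasurableSet P := by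
  obtain ⟨I, J, hI, hJ, rfl⟩ := hP
  exact hI.measurableSet.prod hJ.measurableSet

/-- Every rectangular allocation can be redivided into a proportional (up to a factor 4) one in which agent `i`
keeps at least a fraction `1 / (k i + 1)` of her value, where the `k i` sum to at most `n`. -/
theorem exists_redivision {n : ℕ} (hn : 1 ≤ n) {x₀ x₁ y₀ y₁ : ℝ} {C : Set (ℝ × ℝ)}
    (hC : C = Set.Icc x₀ x₁ ×ˢ Set.Icc y₀ y₁) (μ : Fin n → Measure (ℝ × ℝ))
    [∀ i, IsFiniteMeasure (μ i)] (hμ : ∀ i, μ i ≪ volume) (hpos : ∀ i, 0 < (μ i).real C)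
    {X : Fin n → Set (ℝ × ℝ)} (hX : IsUsableAllocation C parallelRectangles X) :
    ∃ Y, IsUsableAllocation C parallelRectangles Y ∧ ∃ k : Fin n → ℕ, ∑ i, k i ≤ n ∧
      ∀ i, (μ i).real C / (4 * n) ≤ (μ i).real (Y i) ∧
        (μ i).real (X i) ≤ (k i + 1) * (μ i).real (Y i) := by
  have hn0 : (0 : ℝ) < n := by exact_mod_cast hn
  choose I J hI hJ hIJ using hX.2
  obtain ⟨P, Q, hP, hQ, hPA, hQB, hd, hcov, hown, -, -⟩ := exists_rectangle_partition
    (Set.ordConnected_Icc (a := x₀) (b := x₁)) (Set.ordConnected_Icc (a := y₀) (b := y₁))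
    I J hI hJ (fun i => by rw [← hIJ, ← hC]; exact hX.1.2.1 i)
    (fun i j hij => by rw [← hIJ, ← hIJ]; exact hX.1.2.2 i j hij) Finset.univ
  let Z : Option (Fin n × Fin 3) → Set (ℝ × ℝ) := fun j => P j ×ˢ Q j
  have hZm : ∀ j, MeasurableSet (Z j) := fun j => (hP j).measurableSet.prod (hQ j).measurableSet
  have hZC : ∀ j, Z j ⊆ C := fun j => by rw [hC]; exact Set.prod_mono (hPA j) (hQB j)
  have hZd : ∀ j l, j ≠ l → Disjoint (Z j) (Z l) := fun j l hjl =>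
    Set.disjoint_left.2 fun p hp hp' => hjl (hd j l p.1 p.2 hp.1 hp.2 hp'.1 hp'.2)
  have hZsum : ∀ a, ∑ j, (μ a).real (Z j) = (μ a).real C := by
    intro a
    rw [← measureReal_iUnion_fintype (fun j l hjl => hZd j l hjl) hZm]
    congr 1
    refine (Set.iUnion_subset hZC).antisymm fun p hp => ?_
    rw [hC] at hp
    obtain ⟨k, hk⟩ := hcov p.1 hp.1 p.2 hp.2
    exact Set.mem_iUnion.2 ⟨k, hk⟩
  have hXZ : ∀ i, X i ⊆ Z (some (i, 0)) := by
    intro i p hp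
    have hp' := hp
    rw [hIJ] at hp'
    obtain ⟨h1, h2⟩ := hown i (Finset.mem_univ i) ⟨p, hp'⟩
    exact ⟨h1 hp'.1, h2 ▸ hp'.2⟩
  -- These sum to `4 * n` over the `3 * n + 1` cells. The floors together lose strictly less than `3
  -- * n + 1`, so their integer sum exceeds `n - 1`; this is where the factor 4 comes from.
  let r : Fin n → Option (Fin n × Fin 3) → ℝ := fun a j => 4 * n * (μ a).real (Z j) / (μ a).real C
  have hr0 : ∀ a j, 0 ≤ r a j := fun a j => by positivity
  obtain ⟨f, hf, hf'⟩ := exists_assignment (fun a j => ⌊r a j⌋₊)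
    (fun i : Fin n => (some (i, 0) : Option (Fin n × Fin 3)))
    (fun i j h => by simpa using h) (by
      intro a
      have h1 : ∑ j, r a j = 4 * n := by
        simp only [r]
        rw [← Finset.sum_div, ← Finset.mul_sum, hZsum]
        exact mul_div_cancel_right₀ _ (hpos a).ne'
      have h2 : ∑ j, r a j < ∑ j, ((⌊r a j⌋₊ : ℝ) + 1) :=
        Finset.sum_lt_sum_of_nonempty Finset.univ_nonempty fun j _ => Nat.lt_floor_add_one _
      rw [Finset.sum_add_distrib, h1] at h2
      simp only [Finset.sum_const, Finset.card_univ, Fintype.card_option, Fintype.card_prod,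
        Fintype.card_fin, nsmul_eq_mul, mul_one] at h2 ⊢
      have h3 : 4 * n < ∑ j, ⌊r a j⌋₊ + (n * 3 + 1) := by exact_mod_cast h2
      omega)
  let A : Option (Fin n × Fin 3) → Finset (Fin n) := fun j => Finset.univ.filter fun b => f b = j
  have hA : ∀ a, a ∈ A (f a) := fun a => by simp [A]
  have hAcard : ∀ a, 0 < (A (f a)).card := fun a => Finset.card_pos.2 ⟨a, hA a⟩
  choose Y hY hYd using fun j => exists_proportional_division μ hμ
    (fun a => (μ a).real (Z j) / (A j).card) (fun a => by positivity) (hQ j) (A j).card (A j) (P j)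
    rfl (hP j) (hPA j) (by
      intro a ha
      have : ((A j).card : ℝ) ≠ 0 := by
        exact_mod_cast (Finset.card_pos.2 ⟨a, ha⟩).ne'
      exact (mul_div_cancel₀ _ this).le)
  have hYa := fun a => hY (f a) a (hA a)
  have hshare : ∀ a, (μ a).real C / (4 * n) ≤ (μ a).real (Y (f a) a) := by
    intro a
    refine le_trans ?_ (hYa a).2.2
    have h0 : (0 : ℝ) < (A (f a)).card := by exact_mod_cast hAcard a
    have h1 : ((A (f a)).card : ℝ) ≤ r a (f a) :=
      le_trans (by exact_mod_cast hf a) (Nat.floor_le (hr0 a (f a)))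
    simp only [r] at h1
    rw [le_div_iff₀ (hpos a)] at h1
    rw [div_le_div_iff₀ (by positivity) h0]
    linarith
  refine ⟨fun a => Y (f a) a, ⟨⟨fun a => ?_, fun a => ?_, fun a b hab => ?_⟩, fun a => (hYa a).1⟩,
    fun i => (A (some (i, 0))).card, ?_, fun i => ⟨hshare i, ?_⟩⟩
  · exact measurableSet_of_mem_parallelRectangles (hYa a).1
  · exact (hYa a).2.1.trans (hZC (f a))
  · by_cases h : f a = f b
    · have hb := hA b
      rw [← h] at hb
      have := hYd (f a) a (hA a) b hb hab
      dsimp only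
      rwa [← h]
    · exact (hZd _ _ h).mono (hYa a).2.1 (hYa b).2.1
  · have h1 : ∑ j, (A j).card = n := by
      rw [← Finset.card_eq_sum_card_fiberwise fun a _ => Finset.mem_coe.2 (Finset.mem_univ (f a))]
      simp
    calc ∑ i, (A (some (i, 0))).card
        = ∑ j ∈ Finset.univ.image (fun i : Fin n => (some (i, 0) : Option (Fin n × Fin 3))),
            (A j).card := by
          rw [Finset.sum_image]
          intro i _ j _ h
          simpa using h
      _ ≤ ∑ j, (A j).card := Finset.sum_le_sum_of_subset (Finset.subset_univ _)
      _ = n := h1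
  · have h1 : (μ i).real (X i) ≤ (μ i).real (Z (some (i, 0))) := measureReal_mono (hXZ i)
    by_cases h : f i = some (i, 0)
    · have h2 := (hYa i).2.2
      have h0 : (0 : ℝ) < (A (f i)).card := by exact_mod_cast hAcard i
      rw [div_le_iff₀ h0] at h2
      dsimp only
      rw [← h] at h1 ⊢
      have : 0 ≤ (μ i).real (Y (f i) i) := measureReal_nonneg
      linarith
    -- Away from its own cell, agent `i` has at least the floor of its demand as head count there,
    -- so `X i` is worth less than `k i + 1` units, while `hshare` guarantees one unit.
    · have h2 : r i (some (i, 0)) < (A (some (i, 0))).card + 1 := by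
        refine (Nat.lt_floor_add_one _).trans_le ?_
        have := hf' i h
        exact_mod_cast Nat.succ_le_succ this
      simp only [r] at h2
      rw [div_lt_iff₀ (hpos i)] at h2
      have h3 := hshare i
      rw [div_le_iff₀ (by positivity)] at h3
      have h4 : (0 : ℝ) ≤ (A (some (i, 0))).card + 1 := by positivity
      have h5 := mul_le_mul_of_nonneg_left h3 h4
      refine h1.trans (le_of_mul_le_mul_left ?_ (by positivity : (0 : ℝ) < 4 * n))
      linarith

/-! ### Compactness of the attainable values. -/

theorem exists_Ioo_ae_eq {x₀ x₁ : ℝ} (h : x₀ ≤ x₁) {I : Set ℝ} (hI : I.OrdConnected)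
    (hsub : I ⊆ Set.Icc x₀ x₁) :
    ∃ a ∈ Set.Icc x₀ x₁, ∃ b ∈ Set.Icc x₀ x₁, Set.Ioo a b ⊆ I ∧ Set.Ioo a b =ᵐ[volume] I := by
  rcases I.eq_empty_or_nonempty with rfl | hne
  · exact ⟨x₀, ⟨le_rfl, h⟩, x₀, ⟨le_rfl, h⟩, by simp, by simp⟩
  have hb : BddBelow I := bddBelow_Icc.mono hsub
  have ha : BddAbove I := bddAbove_Icc.mono hsub
  have h1 : Set.Ioo (sInf I) (sSup I) ⊆ I :=
    IsConnected.Ioo_csInf_csSup_subset ⟨hne, isPreconnected_iff_ordConnected.2 hI⟩ hb ha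
  obtain ⟨w, hw⟩ := hne
  refine ⟨sInf I, ⟨le_csInf ⟨w, hw⟩ fun x hx => (hsub hx).1, (csInf_le hb hw).trans (hsub hw).2⟩,
    sSup I, ⟨(hsub hw).1.trans (le_csSup ha hw), csSup_le ⟨w, hw⟩ fun x hx => (hsub hx).2⟩, h1, ?_⟩
  refine Filter.EventuallyLE.antisymm h1.eventuallyLE ?_
  exact (subset_Icc_csInf_csSup hb ha).eventuallyLE.trans Ioo_ae_eq_Icc.symm.le

/-- The value vectors of the rectangular allocations form a compact set. -/
theorem isCompact_values {n : ℕ} {x₀ x₁ y₀ y₁ : ℝ} (hx : x₀ ≤ x₁) (hy : y₀ ≤ y₁)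
    {C : Set (ℝ × ℝ)} (hC : C = Set.Icc x₀ x₁ ×ˢ Set.Icc y₀ y₁) (μ : Fin n → Measure (ℝ × ℝ))
    [∀ i, IsFiniteMeasure (μ i)] (hμ : ∀ i, μ i ≪ volume) :
    IsCompact {u : Fin n → ℝ | ∃ X, IsUsableAllocation C parallelRectangles X ∧
      ∀ i, u i = (μ i).real (X i)} := by
  let R : (ℝ × ℝ) × (ℝ × ℝ) → Set (ℝ × ℝ) := fun p => Set.Ioo p.1.1 p.1.2 ×ˢ Set.Ioo p.2.1 p.2.2
  let box : Set ((ℝ × ℝ) × (ℝ × ℝ)) :=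
    (Set.Icc x₀ x₁ ×ˢ Set.Icc x₀ x₁) ×ˢ (Set.Icc y₀ y₁ ×ˢ Set.Icc y₀ y₁)
  have hRm : ∀ p, MeasurableSet (R p) := fun p => measurableSet_Ioo.prod measurableSet_Ioo
  have hbox : IsCompact box := (isCompact_Icc.prod isCompact_Icc).prod (isCompact_Icc.prod isCompact_Icc)
  -- Allocations are parametrised by the corners of open rectangles. Passing to open rectangles
  -- changes no value and makes disjointness a closed condition, `min ≤ max` on the endpoints.
  let K : Set (Fin n → (ℝ × ℝ) × (ℝ × ℝ)) :=
    (Set.univ.pi fun _ => box) ∩ {p | ∀ i j, i ≠ j → Disjoint (R (p i)) (R (p j))}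
  have hK : IsCompact K := by
    refine (isCompact_univ_pi fun _ => hbox).inter_right ?_
    simp only [Set.ofPred_forall]
    refine isClosed_iInter fun i => isClosed_iInter fun j => isClosed_iInter fun _ => ?_
    simp only [R, Set.disjoint_prod, Set.Ioo_disjoint_Ioo, Set.ofPred_or]
    exact (isClosed_le (by fun_prop) (by fun_prop)).union (isClosed_le (by fun_prop) (by fun_prop))
  have hcont : Continuous fun (p : Fin n → (ℝ × ℝ) × (ℝ × ℝ)) i => (μ i).real (R (p i)) := by
    refine continuous_pi fun i => ?_
    have h : Continuous fun p => (μ i).real (R p) := by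
      refine continuous_measureReal _ hRm fun p => ?_
      filter_upwards [ae_fst_ne (hμ i) p.1.1, ae_fst_ne (hμ i) p.1.2, ae_snd_ne (hμ i) p.2.1,
        ae_snd_ne (hμ i) p.2.2] with z h1 h2 h3 h4
      filter_upwards [eventually_gt_iff (f := fun p : (ℝ × ℝ) × (ℝ × ℝ) => p.1.1) (by fun_prop) h1,
        eventually_lt_iff (f := fun p : (ℝ × ℝ) × (ℝ × ℝ) => p.1.2) (by fun_prop) h2,
        eventually_gt_iff (f := fun p : (ℝ × ℝ) × (ℝ × ℝ) => p.2.1) (by fun_prop) h3,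
        eventually_lt_iff (f := fun p : (ℝ × ℝ) × (ℝ × ℝ) => p.2.2) (by fun_prop) h4]
        with t e1 e2 e3 e4
      exact and_congr (and_congr e1 e2) (and_congr e3 e4)
    exact h.comp (continuous_apply i)
  convert hK.image hcont using 1
  ext u
  constructor
  · rintro ⟨X, hX, hu⟩
    choose I J hI hJ hIJ using hX.2
    have hp : ∀ i, ∃ p ∈ box, R p ⊆ X i ∧ (μ i).real (R p) = (μ i).real (X i) := by
      intro i
      by_cases hne : (X i).Nonempty
      swap
      · rw [Set.not_nonempty_iff_eq_empty] at hne
        refine ⟨((x₀, x₀), (y₀, y₀)), ⟨⟨⟨le_rfl, hx⟩, ⟨le_rfl, hx⟩⟩, ⟨⟨le_rfl, hy⟩, ⟨le_rfl, hy⟩⟩⟩,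
          ?_, ?_⟩ <;> simp [R, hne]
      obtain ⟨z, hz⟩ := hne
      have hXC : I i ×ˢ J i ⊆ Set.Icc x₀ x₁ ×ˢ Set.Icc y₀ y₁ := by
        rw [← hIJ, ← hC]; exact hX.1.2.1 i
      rw [hIJ] at hz
      obtain ⟨a, ha, b, hb, hab, hab'⟩ := exists_Ioo_ae_eq hx (hI i)
        fun x hx => (hXC (Set.mk_mem_prod hx hz.2)).1
      obtain ⟨c, hc, d, hd, hcd, hcd'⟩ := exists_Ioo_ae_eq hy (hJ i)
        fun y hy => (hXC (Set.mk_mem_prod hz.1 hy)).2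
      refine ⟨((a, b), (c, d)), ⟨⟨ha, hb⟩, ⟨hc, hd⟩⟩, ?_, ?_⟩
      · rw [hIJ]; exact Set.prod_mono hab hcd
      · rw [hIJ]
        exact measureReal_congr ((hμ i).ae_eq (Measure.set_prod_ae_eq hab' hcd'))
    choose p hpb hpX hpv using hp
    refine ⟨p, ⟨fun i _ => hpb i, fun i j hij => (hX.1.2.2 i j hij).mono (hpX i) (hpX j)⟩, ?_⟩
    funext i
    exact (hpv i).trans (hu i).symm
  · rintro ⟨p, ⟨hpb, hpd⟩, rfl⟩
    refine ⟨fun i => R (p i), ⟨⟨fun i => hRm _, fun i => ?_, hpd⟩, fun i =>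
      ⟨_, _, Set.ordConnected_Ioo, Set.ordConnected_Ioo, rfl⟩⟩, fun i => rfl⟩
    obtain ⟨⟨h1, h2⟩, ⟨h3, h4⟩⟩ := hpb i (Set.mem_univ i)
    rw [hC]
    exact Set.prod_mono (Set.Ioo_subset_Icc_self.trans (Set.Icc_subset_Icc h1.1 h2.2))
      (Set.Ioo_subset_Icc_self.trans (Set.Icc_subset_Icc h3.1 h4.2))

/-! ### Densities as measures, and existence of the price. -/

/-- The measure with density `v` on the cake `C`. -/
noncomputable def valueMeasure (C : Set (ℝ × ℝ)) (v : ℝ × ℝ → ℝ) : Measure (ℝ × ℝ) :=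
  (volume.restrict C).withDensity fun x => ENNReal.ofReal (v x)

theorem valueMeasure_absolutelyContinuous (C : Set (ℝ × ℝ)) (v : ℝ × ℝ → ℝ) :
    valueMeasure C v ≪ volume :=
  (withDensity_absolutelyContinuous _ _).trans Measure.restrict_le_self.absolutelyContinuous

theorem isFiniteMeasure_valueMeasure {C : Set (ℝ × ℝ)} {v : ℝ × ℝ → ℝ}
    (hv : IsValueDensity C v) : IsFiniteMeasure (valueMeasure C v) :=
  isFiniteMeasure_withDensity_ofReal hv.integrableOn.2

theorem valueMeasure_real {C : Set (ℝ × ℝ)} {v : ℝ × ℝ → ℝ} (hv : IsValueDensity C v)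
    {P : Set (ℝ × ℝ)} (hP : MeasurableSet P) (hPC : P ⊆ C) :
    (valueMeasure C v).real P = value v P := by
  rw [value, integral_eq_lintegral_of_nonneg_ae, measureReal_def, valueMeasure,
    withDensity_apply _ hP, Measure.restrict_restrict hP, Set.inter_eq_left.2 hPC]
  · filter_upwards [ae_restrict_mem hP] with x hx
    exact hv.nonneg x (hPC hx)
  · exact (hv.integrableOn.mono_set hPC).1

/-- The price of proportionality of a continuous welfare function exists if every allocation can
be replaced by a proportional one at the loss of at most a factor `κ` of welfare. -/
theorem exists_isPriceOfFairness {n : ℕ} {C : Set (ℝ × ℝ)} {S : Set (Set (ℝ × ℝ))}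
    {v : Fin n → ℝ × ℝ → ℝ} {r κ : ℝ} (G : (Fin n → ℝ) → ℝ) (hG : Continuous G)
    (hT : IsCompact {u : Fin n → ℝ | ∃ X, IsUsableAllocation C S X ∧ ∀ i, u i = value (v i) (X i)})
    (hne : ∃ X : Fin n → Set (ℝ × ℝ), IsUsableAllocation C S X)
    (hpos : ∀ Y, IsUsableAllocation C S Y → IsProportional r C v Y →
      0 < G fun i => value (v i) (Y i))
    (hκ : ∀ X, IsUsableAllocation C S X → ∃ Y, IsUsableAllocation C S Y ∧ IsProportional r C v Y ∧
      G (fun i => value (v i) (X i)) ≤ κ * G fun i => value (v i) (Y i)) (hκ0 : 0 ≤ κ) :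
    ∃ p, IsPriceOfFairness C S (fun X => G fun i => value (v i) (X i)) (IsProportional r C v) p ∧
      p ≤ κ := by
  obtain ⟨X₀, hX₀⟩ := hne
  obtain ⟨Y₀, hY₀, hYp₀, -⟩ := hκ X₀ hX₀
  obtain ⟨u, ⟨X, hX, hu⟩, hmax⟩ := hT.exists_isMaxOn ⟨_, X₀, hX₀, fun i => rfl⟩ hG.continuousOn
  -- Proportionality is a closed condition on value vectors, so the fair ones are compact too.
  have hF : IsClosed {u : Fin n → ℝ | ∀ i, r / n * value (v i) C ≤ u i} := by
    simp only [Set.ofPred_forall]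
    exact isClosed_iInter fun i => isClosed_le continuous_const (continuous_apply i)
  obtain ⟨w, ⟨⟨Y, hY, hw⟩, hwp⟩, hmax'⟩ := (hT.inter_right hF).exists_isMaxOn
    ⟨_, ⟨Y₀, hY₀, fun i => rfl⟩, hYp₀⟩ hG.continuousOn
  obtain rfl : u = fun i => value (v i) (X i) := funext hu
  obtain rfl : w = fun i => value (v i) (Y i) := funext hw
  have hD := hpos Y hY hwp
  refine ⟨_, ⟨_, _, ⟨⟨X, hX, rfl⟩, ?_⟩, ⟨⟨Y, hY, hwp, rfl⟩, ?_⟩, hD, rfl⟩, ?_⟩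
  · rintro _ ⟨X', hX', rfl⟩
    exact hmax ⟨X', hX', fun i => rfl⟩
  · rintro _ ⟨Y', hY', hYp', rfl⟩
    exact hmax' ⟨⟨Y', hY', fun i => rfl⟩, hYp'⟩
  · rw [div_le_iff₀ hD]
    obtain ⟨Y', hY', hYp', hle⟩ := hκ X hX
    exact hle.trans (mul_le_mul_of_nonneg_left (hmax' ⟨⟨Y', hY', fun i => rfl⟩, hYp'⟩) hκ0)

/-! ### The two welfare inequalities. -/

/-- Since `a i ≤ 1`, also `a i ^ 2 ≤ (k i + 1) * b i`, and Cauchy–Schwarz gives `(∑ a i) ^ 2 ≤ 2 * n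
* D` with `D = ∑ b i`. As `D ≥ 1/4`, this is at most `8 * n * D ^ 2`, and 8 is rounded up to the
square 9. -/
theorem sum_le_three_mul_sqrt_mul_sum {n : ℕ} (hn : 1 ≤ n) {k : Fin n → ℕ} (hk : ∑ i, k i ≤ n)
    {a b : Fin n → ℝ} (ha0 : ∀ i, 0 ≤ a i) (ha1 : ∀ i, a i ≤ 1) (hb : ∀ i, 1 / (4 * n) ≤ b i)
    (hab : ∀ i, a i ≤ (k i + 1) * b i) :
    ∑ i, a i ≤ 3 * √n * ∑ i, b i := by
  have hn0 : (0 : ℝ) < n := by exact_mod_cast hn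
  have hb0 : ∀ i, 0 ≤ b i := fun i => le_trans (by positivity) (hb i)
  set D := ∑ i, b i with hD
  have hD0 : 1 / 4 ≤ D := by
    have := Finset.sum_le_sum fun (i : Fin n) (_ : i ∈ Finset.univ) => hb i
    simp only [Finset.sum_const, Finset.card_univ, Fintype.card_fin, nsmul_eq_mul] at this
    refine le_trans (le_of_eq ?_) this
    field_simp
  have hksum : ∑ i, ((k i : ℝ) + 1) ≤ 2 * n := by
    rw [Finset.sum_add_distrib]
    have : (∑ i, (k i : ℝ)) ≤ n := by exact_mod_cast hk
    simp only [Finset.sum_const, Finset.card_univ, Fintype.card_fin, nsmul_eq_mul, mul_one]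
    linarith
  have hcs : (∑ i, a i) ^ 2 ≤ (∑ i, ((k i : ℝ) + 1)) * D := by
    refine Finset.sum_sq_le_sum_mul_sum_of_sq_le_mul Finset.univ (fun i _ => by positivity)
      (fun i _ => hb0 i) fun i _ => le_trans ?_ (hab i)
    nlinarith [ha0 i, ha1 i]
  refine abs_le_of_sq_le_sq' ?_ (by positivity) |>.2
  have h2 : (3 * √n * D) ^ 2 = 9 * n * D ^ 2 := by
    rw [mul_pow, mul_pow, Real.sq_sqrt hn0.le]; norm_num
  rw [h2]
  have h3 : (∑ i, ((k i : ℝ) + 1)) * D ≤ 2 * n * D := by gcongr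
  nlinarith [mul_nonneg hn0.le (mul_nonneg (by linarith : 0 ≤ D) (sub_nonneg.2 hD0)),
    mul_nonneg hn0.le (sq_nonneg D)]

/-- The geometric mean of the factors `k i + 1` is at most their arithmetic mean, which is at most
2. -/
theorem prod_rpow_le_two_mul_prod_rpow {n : ℕ} (hn : 1 ≤ n) {k : Fin n → ℕ} (hk : ∑ i, k i ≤ n)
    {a b : Fin n → ℝ} (ha0 : ∀ i, 0 ≤ a i) (hb0 : ∀ i, 0 ≤ b i)
    (hab : ∀ i, a i ≤ (k i + 1) * b i) :
    (∏ i, a i) ^ (1 / n : ℝ) ≤ 2 * (∏ i, b i) ^ (1 / n : ℝ) := by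
  have hn0 : (0 : ℝ) < n := by exact_mod_cast hn
  have hprod : (∏ i, ((k i : ℝ) + 1)) ^ (1 / n : ℝ) ≤ 2 := by
    have h := Real.geom_mean_le_arith_mean_weighted Finset.univ (fun _ : Fin n => (1 / n : ℝ))
      (fun i => (k i : ℝ) + 1) (fun i _ => by positivity) (by simp [hn0.ne'])
      (fun i _ => by positivity)
    rw [Real.finsetProd_rpow _ _ (fun i _ => by positivity), ← Finset.mul_sum,
      Finset.sum_add_distrib] at h
    refine h.trans ?_
    have : (∑ i, (k i : ℝ)) ≤ n := by exact_mod_cast hk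
    simp only [Finset.sum_const, Finset.card_univ, Fintype.card_fin, nsmul_eq_mul, mul_one]
    rw [one_div, inv_mul_le_iff₀ hn0]
    linarith
  calc (∏ i, a i) ^ (1 / n : ℝ) ≤ (∏ i, ((k i : ℝ) + 1) * b i) ^ (1 / n : ℝ) :=
        Real.rpow_le_rpow (Finset.prod_nonneg fun i _ => ha0 i)
          (Finset.prod_le_prod (fun i _ => ha0 i) fun i _ => hab i) (by positivity)
    _ = (∏ i, ((k i : ℝ) + 1)) ^ (1 / n : ℝ) * (∏ i, b i) ^ (1 / n : ℝ) := by
        rw [Finset.prod_mul_distrib, Real.mul_rpow (Finset.prod_nonneg fun i _ => by positivity)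
          (Finset.prod_nonneg fun i _ => hb0 i)]
    _ ≤ 2 * (∏ i, b i) ^ (1 / n : ℝ) :=
        mul_le_mul_of_nonneg_right hprod
          (Real.rpow_nonneg (Finset.prod_nonneg fun i _ => hb0 i) _)

end CakeCutting

theorem theorem9 :
    ∃ K : ℝ, ∀ B : ℝ, 4 ≤ B →
      ∀ n : ℕ, 1 ≤ n →
      ∀ x₀ x₁ y₀ y₁ : ℝ, x₀ < x₁ → y₀ < y₁ →
      ∀ C : Set (ℝ × ℝ), C = Set.Icc x₀ x₁ ×ˢ Set.Icc y₀ y₁ →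
      ∀ v : Fin n → ℝ × ℝ → ℝ,
        (∀ i, CakeCutting.IsValueDensity C (v i)) →
        (∀ i, 0 < CakeCutting.value (v i) C) →
        (∃ p : ℝ,
          CakeCutting.IsPriceOfFairness C CakeCutting.parallelRectangles
            (CakeCutting.utilitarianWelfare C v) (CakeCutting.IsProportional (1 / B) C v) p ∧
          p ≤ K * Real.sqrt n) ∧
        (∃ p : ℝ,
          CakeCutting.IsPriceOfFairness C CakeCutting.parallelRectangles
            (CakeCutting.nashWelfare C v) (CakeCutting.IsProportional (1 / B) C v) p ∧
          p ≤ 11.2) := by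
  open CakeCutting in
  refine ⟨3, fun B hB n hn x₀ x₁ y₀ y₁ hx hy C hC v hv hpos => ?_⟩
  have hn0 : (0 : ℝ) < n := by exact_mod_cast hn
  have hB0 : 0 < B := by linarith
  have hCm : MeasurableSet C := by rw [hC]; exact measurableSet_Icc.prod measurableSet_Icc
  have hfin := fun i => isFiniteMeasure_valueMeasure (hv i)
  have hac := fun i => valueMeasure_absolutelyContinuous C (v i)
  have hval : ∀ {X}, IsUsableAllocation C parallelRectangles X → ∀ i,
      (valueMeasure C (v i)).real (X i) = value (v i) (X i) := fun hX i =>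
    valueMeasure_real (hv i) (hX.1.1 i) (hX.1.2.1 i)
  have hvalC : ∀ i, (valueMeasure C (v i)).real C = value (v i) C := fun i =>
    valueMeasure_real (hv i) hCm subset_rfl
  have hT : IsCompact {u : Fin n → ℝ | ∃ X, IsUsableAllocation C parallelRectangles X ∧
      ∀ i, u i = value (v i) (X i)} := by
    convert isCompact_values hx.le hy.le hC (fun i => valueMeasure C (v i)) hac using 3 with u
    exact exists_congr fun X => and_congr_right fun hX => forall_congr' fun i => by rw [hval hX]
  have hne : ∃ X : Fin n → _, IsUsableAllocation C parallelRectangles X :=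
    ⟨fun _ => ∅, ⟨fun _ => MeasurableSet.empty, fun _ => Set.empty_subset _,
      fun _ _ _ => Set.disjoint_empty _⟩,
      fun _ => ⟨∅, ∅, Set.ordConnected_empty, Set.ordConnected_empty, by simp⟩⟩
  have hratio0 : ∀ {X}, IsUsableAllocation C parallelRectangles X → ∀ i,
      0 ≤ value (v i) (X i) / value (v i) C := fun hX i => by
    rw [← hval hX]; exact div_nonneg measureReal_nonneg (hpos i).le
  have hratio1 : ∀ {X}, IsUsableAllocation C parallelRectangles X → ∀ i,
      value (v i) (X i) / value (v i) C ≤ 1 := fun hX i => by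
    rw [← hval hX, ← hvalC]
    exact div_le_one_of_le₀ (measureReal_mono (hX.1.2.1 i)) measureReal_nonneg
  have hpropos : ∀ {Y}, IsProportional (1 / B) C v Y → ∀ i,
      0 < value (v i) (Y i) / value (v i) C := fun hY i =>
    div_pos (lt_of_lt_of_le (mul_pos (by positivity) (hpos i)) (hY i)) (hpos i)
  have hred : ∀ X, IsUsableAllocation C parallelRectangles X →
      ∃ Y, IsUsableAllocation C parallelRectangles Y ∧ IsProportional (1 / B) C v Y ∧
        ∃ k : Fin n → ℕ, ∑ i, k i ≤ n ∧
          (∀ i, 1 / (4 * n) ≤ value (v i) (Y i) / value (v i) C) ∧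
          ∀ i, value (v i) (X i) / value (v i) C ≤
            (k i + 1) * (value (v i) (Y i) / value (v i) C) := by
    intro X hX
    obtain ⟨Y, hY, k, hk, h⟩ := exists_redivision hn hC (fun i => valueMeasure C (v i)) hac
      (fun i => by rw [hvalC]; exact hpos i) hX
    simp only [hval hX, hval hY, hvalC] at h
    refine ⟨Y, hY, fun i => le_trans ?_ (h i).1, k, hk, fun i => ?_, fun i => ?_⟩
    · rw [div_div, one_div_mul_eq_div]
      have := (hpos i).le
      gcongr
    · rw [le_div_iff₀ (hpos i), one_div_mul_eq_div]
      exact (h i).1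
    · rw [← mul_div_assoc]
      exact div_le_div_of_nonneg_right (h i).2 (hpos i).le
  have : Nonempty (Fin n) := ⟨⟨0, hn⟩⟩
  constructor
  · refine exists_isPriceOfFairness (fun u => 1 / n * ∑ i, u i / value (v i) C)
      (by fun_prop) hT hne (fun Y hY hYp => ?_) (fun X hX => ?_) (by positivity)
    · exact mul_pos (by positivity)
        (Finset.sum_pos (fun i _ => hpropos hYp i) Finset.univ_nonempty)
    · obtain ⟨Y, hY, hYp, k, hk, h1, h2⟩ := hred X hX
      refine ⟨Y, hY, hYp, ?_⟩
      have := sum_le_three_mul_sqrt_mul_sum hn hk (hratio0 hX) (hratio1 hX) h1 h2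
      calc 1 / n * ∑ i, value (v i) (X i) / value (v i) C
          ≤ 1 / n * (3 * √n * ∑ i, value (v i) (Y i) / value (v i) C) := by gcongr
        _ = _ := by ring
  -- The argument yields the bound 2, well below the required 11.2.
  · obtain ⟨p, hp, hp2⟩ := exists_isPriceOfFairness (κ := 2) (r := 1 / B)
      (fun u => (∏ i, u i / value (v i) C) ^ (1 / n : ℝ))
      (Continuous.rpow_const (by fun_prop) fun _ => Or.inr (by positivity)) hT hne
      (fun Y hY hYp => Real.rpow_pos_of_pos (Finset.prod_pos fun i _ => hpropos hYp i) _)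
      (fun X hX => by
        obtain ⟨Y, hY, hYp, k, hk, -, h2⟩ := hred X hX
        exact ⟨Y, hY, hYp, prod_rpow_le_two_mul_prod_rpow hn hk (hratio0 hX) (hratio0 hY) h2⟩)
      (by norm_num)
    exact ⟨p, hp, hp2.trans (by norm_num)⟩
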